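/- Let $\mathbb{D}$ be the open unit disc in $\mathbb{C}$, let $X\subset\mathbb{C}$ be open, and let $f:\overline{\mathbb{D}}\to X$ be continuous, holomorphic on $\mathbb{D}$, and such that $f|_{\mathbb{D}}$ is proper as a map from $\mathbb{D}$ onto its image $f(\mathbb{D})$ (that is, $\{z\in\mathbb{D}: f(z)\in K\}$ is compact for every compact $K\subset f(\mathbb{D})$). Then for every holomorphic $g:\mathbb{D}\to X$ with $g(\mathbb{D})\subset f(\mathbb{D})$ and $g(0)=f(0)$, and for every $p\in X$, $$\sum_{b\in \mathbb{D}\cap g^{-1}(p)} m_b\log|b| \;\ge\; \sum_{a\in \mathbb{D}\cap f^{-1}(p)} m_a\log|a| .$$ Here $m_b$ and $m_a$ are the multiplicities of $b$ and $a$ as zeros of $g-p$ and $f-p$, respectively (with $m_b=\infty$ if $g\equiv p$); the sums of nonpositive terms are taken in $[-\infty,0]$, with $\log 0=-\infty$, and an empty sum is $0$. -/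

import Mathlib

open Set Metric Filter Topology

noncomputable section

namespace LogFiber

/-- The fibre of `h` over `p` in the open unit disc. -/
def fiber (h : ℂ → ℂ) (p : ℂ) : Set ℂ := {z | z ∈ ball (0 : ℂ) 1 ∧ h z = p}

/-- The multiplicity of `a` as a zero of `h - p`; it is `⊤` exactly when `h` is constantly `p`
near `a` (for `h` analytic at `a`). -/
def mult (h : ℂ → ℂ) (p a : ℂ) : ℕ∞ := analyticOrderAt (fun z => h z - p) a

/-- The extended real number `m_a * log |a|`, with `log 0 = -∞`. -/
def term (h : ℂ → ℂ) (p a : ℂ) : EReal :=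
  (((mult h p a : ℕ∞) : ENNReal) : EReal) * ENNReal.log ‖a‖ₑ

/-- The sum of `m_a * log |a|` over all points `a` of the open unit disc with `h a = p`. All terms
are `≤ 0`, so the sum always exists in `[-∞, 0]` (see `hasSum_logSum`); it is `0` when the fibre
is empty. -/
def logSum (h : ℂ → ℂ) (p : ℂ) : EReal := ∑' a : fiber h p, term h p a

/-- `f` restricted to the open unit disc is a proper map onto its image (a subspace of `ℂ`). -/
def ProperOntoImage (f : ℂ → ℂ) : Prop :=
  IsProperMap (Set.imageFactorization f (ball (0 : ℂ) 1))

theorem term_nonpos (h : ℂ → ℂ) (p : ℂ) (a : fiber h p) : term h p a ≤ 0 := by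
  have ha : ‖(a : ℂ)‖ₑ ≤ 1 := by
    have h1 : ‖(a : ℂ)‖ < 1 := by simpa using a.2.1
    rw [← ofReal_norm]
    exact ENNReal.ofReal_le_one.2 h1.le
  have hl : ENNReal.log ‖(a : ℂ)‖ₑ ≤ 0 := by
    rw [← ENNReal.log_one]
    exact ENNReal.log_monotone ha
  exact mul_nonpos_of_nonneg_of_nonpos (EReal.coe_ennreal_nonneg _) hl

theorem hasSum_logSum (h : ℂ → ℂ) (p : ℂ) :
    HasSum (fun a : fiber h p => term h p a) (logSum h p) :=
  (hasSum_of_isGLB_of_nonpos _ (term_nonpos h p) (isGLB_iInf)).summable.hasSum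

end LogFiber

end

/-! The proof is a Lindelöf-type argument on the curve `g z = f w` in the bidisc. Properness makes
the fibre of `f` over `p` finite when `p` is in the image; let `B_S` be its Blaschke product and
`B_T` that of any finite part of the fibre of `g`. On the curve, `B_S(w) / B_T(z)` has no poles,
being the product of `Q = B_S / (f - p)` in `w` and `R = (g - p) / B_T` in `z`. Its modulus has
limsup at most 1 at the ends of the curve: `|B_S| ≤ 1`, `|B_T| → 1` at the circle, and properness
keeps `w` in a compact set while `z` stays in one. The maximum principle (`norm_mul_lt_of_compact`)
bounds it by 1 everywhere. At `(0, 0)`, on the curve since `g 0 = f 0`, this reads `|B_S(0)| ≤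
|B_T(0)|`; take logarithms and let `T` grow. -/

namespace LogFiber

/-! ### Maximum principle on a possibly singular curve -/

/-- A nonconstant analytic function is `h z₀ + t ^ m` in a suitable local parametrization. -/
theorem exists_parametrization {h : ℂ → ℂ} {z₀ : ℂ} (hh : AnalyticAt ℂ h z₀)
    (hn : ¬ ∀ᶠ z in 𝓝 z₀, h z = h z₀) :
    ∃ m : ℕ, m ≠ 0 ∧ ∃ ζ : ℂ → ℂ, AnalyticAt ℂ ζ 0 ∧ ζ 0 = z₀ ∧
      ∀ᶠ t in 𝓝 (0 : ℂ), h (ζ t) = h z₀ + t ^ m := by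
  have hsub : AnalyticAt ℂ (fun z => h z - h z₀) z₀ := hh.fun_sub analyticAt_const
  have htop : analyticOrderAt (fun z => h z - h z₀) z₀ ≠ ⊤ := by
    rw [Ne, analyticOrderAt_eq_top]
    simpa [sub_eq_zero] using hn
  obtain ⟨m, hm⟩ := ENat.ne_top_iff_exists.1 htop
  have hm0 : m ≠ 0 := by
    rintro rfl
    exact (hsub.analyticOrderAt_eq_zero.1 hm.symm) (sub_self _)
  obtain ⟨k, hk, hk0, hke⟩ := hsub.analyticOrderAt_eq_natCast.1 hm.symm
  obtain ⟨c, hc⟩ := IsAlgClosed.exists_pow_nat_eq (k z₀) (Nat.pos_of_ne_zero hm0)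
  have hc0 : c ≠ 0 := by
    rintro rfl
    exact hk0 (by rw [← hc, zero_pow hm0])
  -- An `m`-th root of `k` near `z₀`: the quotient `k z / k z₀` is near 1, away from the branch cut.
  let r : ℂ → ℂ := fun z => c * Complex.exp (Complex.log (k z / k z₀) / m)
  have hr : AnalyticAt ℂ r z₀ := by
    refine analyticAt_const.mul (AnalyticAt.cexp ?_)
    refine (AnalyticAt.clog (hk.div analyticAt_const hk0) ?_).div analyticAt_const
      (Nat.cast_ne_zero.2 hm0)
    simp [div_self hk0]
  have hr0 : r z₀ = c := by simp [r, div_self hk0]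
  have hrpow : ∀ᶠ z in 𝓝 z₀, r z ^ m = k z := by
    filter_upwards [hk.continuousAt.eventually_ne hk0] with z hz
    have hm0' : (m : ℂ) ≠ 0 := Nat.cast_ne_zero.2 hm0
    simp only [r]
    rw [mul_pow, hc, ← Complex.exp_nat_mul, mul_div_cancel₀ _ hm0',
      Complex.exp_log (div_ne_zero hz hk0), mul_div_cancel₀ _ hk0]
  let φ : ℂ → ℂ := fun z => (z - z₀) * r z
  have hφ : AnalyticAt ℂ φ z₀ := (analyticAt_id.fun_sub analyticAt_const).fun_mul hr
  have hφ0 : φ z₀ = 0 := by simp [φ]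
  have hd : deriv φ z₀ ≠ 0 := by
    have h1 : HasDerivAt φ (1 * r z₀ + (z₀ - z₀) * deriv r z₀) z₀ :=
      ((hasDerivAt_id z₀).sub_const z₀).mul hr.differentiableAt.hasDerivAt
    rw [h1.deriv, hr0]
    simpa using hc0
  refine ⟨m, hm0, hφ.hasStrictDerivAt.localInverse _ _ _ hd, ?_, ?_, ?_⟩
  · simpa [hφ0] using hφ.analyticAt_localInverse hd
  · have : hφ.hasStrictDerivAt.localInverse _ _ _ hd (φ z₀) = z₀ :=
      HasStrictFDerivAt.localInverse_apply_image ..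
    rwa [hφ0] at this
  · have h1 := HasStrictDerivAt.eventually_right_inverse hφ.hasStrictDerivAt hd
    have h2 := (hφ.analyticAt_localInverse hd).continuousAt.tendsto
    have h3 : hφ.hasStrictDerivAt.localInverse _ _ _ hd (φ z₀) = z₀ :=
      HasStrictFDerivAt.localInverse_apply_image ..
    rw [h3] at h2
    rw [hφ0] at h1 h2
    filter_upwards [h1, h2.eventually hke, h2.eventually hrpow] with t ht1 ht2 ht3
    rw [smul_eq_mul, ← ht3, ← mul_pow] at ht2
    rw [← sub_eq_iff_eq_add', ht2]
    exact congrArg (· ^ m) ht1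

/-- Local maximum principle on the curve `g z = f z'`. -/
theorem eventually_exists_norm_mul_eq {f g Q R : ℂ → ℂ} {z₀ w₀ : ℂ}
    (hf : AnalyticAt ℂ f w₀) (hg : AnalyticAt ℂ g z₀)
    (hfn : ¬ ∀ᶠ z in 𝓝 w₀, f z = f w₀) (hgn : ¬ ∀ᶠ z in 𝓝 z₀, g z = g z₀)
    (hQ : AnalyticAt ℂ Q w₀) (hR : AnalyticAt ℂ R z₀) (h0 : g z₀ = f w₀)
    {U V : Set ℂ} (hU : U ∈ 𝓝 z₀) (hV : V ∈ 𝓝 w₀)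
    (hmax : ∀ z ∈ U, ∀ w ∈ V, g z = f w → ‖Q w * R z‖ ≤ ‖Q w₀ * R z₀‖) :
    ∀ᶠ z in 𝓝 z₀, ∃ w ∈ V, g z = f w ∧ ‖Q w * R z‖ = ‖Q w₀ * R z₀‖ := by
  obtain ⟨m, hm, ζ, hζ, hζ0, hζe⟩ := exists_parametrization hg hgn
  obtain ⟨n, hn, ω, hω, hω0, hωe⟩ := exists_parametrization hf hfn
  have hpow : ∀ k : ℕ, k ≠ 0 → AnalyticAt ℂ (fun t : ℂ => t ^ k) 0 := fun k _ => by fun_prop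
  have htend : ∀ k : ℕ, k ≠ 0 → Tendsto (fun t : ℂ => t ^ k) (𝓝 0) (𝓝 0) := fun k hk => by
    simpa [zero_pow hk] using (hpow k hk).continuousAt.tendsto
  -- The crossed exponents make both sides equal `g z₀ + t ^ (n * m)`. One branch of the curve is
  -- enough, since its projection to `z` is already open.
  let z : ℂ → ℂ := fun t => ζ (t ^ n)
  let w : ℂ → ℂ := fun t => ω (t ^ m)
  have hz0 : z 0 = z₀ := by simp [z, zero_pow hn, hζ0]
  have hw0 : w 0 = w₀ := by simp [w, zero_pow hm, hω0]
  have hz : AnalyticAt ℂ z 0 :=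
    AnalyticAt.fun_comp (by simpa [zero_pow hn] using hζ) (hpow n hn)
  have hw : AnalyticAt ℂ w 0 :=
    AnalyticAt.fun_comp (by simpa [zero_pow hm] using hω) (hpow m hm)
  have hzt : Tendsto z (𝓝 0) (𝓝 z₀) := by simpa [hz0] using hz.continuousAt.tendsto
  have hwt : Tendsto w (𝓝 0) (𝓝 w₀) := by simpa [hw0] using hw.continuousAt.tendsto
  have hgz : ∀ᶠ t in 𝓝 (0 : ℂ), g (z t) = g z₀ + t ^ (n * m) := by
    filter_upwards [(htend n hn).eventually hζe] with t ht
    rw [pow_mul]; exact ht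
  have hfw : ∀ᶠ t in 𝓝 (0 : ℂ), f (w t) = g z₀ + t ^ (n * m) := by
    filter_upwards [(htend m hm).eventually hωe] with t ht
    rw [mul_comm, pow_mul, h0]; exact ht
  let F : ℂ → ℂ := fun t => Q (w t) * R (z t)
  have hF : AnalyticAt ℂ F 0 :=
    (AnalyticAt.fun_comp (by rwa [hw0]) hw).fun_mul (AnalyticAt.fun_comp (by rwa [hz0]) hz)
  have hF0 : F 0 = Q w₀ * R z₀ := by simp [F, hz0, hw0]
  have hFmax : IsLocalMax (norm ∘ F) 0 := by
    filter_upwards [hgz, hfw, hzt hU, hwt hV] with t h1 h2 h3 h4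
    simp only [Function.comp, hF0]
    exact hmax _ h3 _ h4 (h1.trans h2.symm)
  have hFc : ∀ᶠ t in 𝓝 (0 : ℂ), F t = F 0 := by
    refine Complex.eventually_eq_of_isLocalMax_norm ?_ hFmax
    exact hF.eventually_analyticAt.mono fun _ h => h.differentiableAt
  have hopen : 𝓝 (z 0) ≤ map z (𝓝 0) := by
    refine hz.eventually_constant_or_nhds_le_map_nhds.resolve_left fun hconst => ?_
    have h1 : ∀ᶠ t in 𝓝 (0 : ℂ), t = 0 := by
      filter_upwards [hconst, hgz] with t ht1 ht2
      rw [ht1, hz0, left_eq_add] at ht2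
      exact eq_zero_of_pow_eq_zero ht2
    obtain ⟨t, ht, ht0⟩ := ((h1.filter_mono nhdsWithin_le_nhds).and
      (self_mem_nhdsWithin (s := {0}ᶜ))).exists
    exact ht0 ht
  rw [hz0] at hopen
  refine hopen ?_
  rw [mem_map]
  filter_upwards [hgz, hfw, hwt hV, hFc] with t h1 h2 h3 h4
  exact ⟨w t, h3, h1.trans h2.symm, by rw [← hF0, ← h4]⟩

/-- Maximum principle on the curve `g z = f z'`. -/
theorem norm_mul_lt_of_compact {f g Q R : ℂ → ℂ} {D K L : Set ℂ} (hD : IsOpen D)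
    (hf : AnalyticOnNhd ℂ f D) (hg : AnalyticOnNhd ℂ g D)
    (hfn : ∀ w ∈ D, ¬ ∀ᶠ z in 𝓝 w, f z = f w) (hgn : ∀ w ∈ D, ¬ ∀ᶠ z in 𝓝 w, g z = g w)
    (hQ : AnalyticOnNhd ℂ Q D) (hR : AnalyticOnNhd ℂ R D)
    (hK : IsCompact K) (hL : IsCompact L) (hKD : K ⊆ D) (hLD : L ⊆ D) {c : ℝ}
    (hc : ∀ z ∈ D, ∀ w ∈ D, g z = f w → c ≤ ‖Q w * R z‖ → z ∈ K ∧ w ∈ L)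
    {z w : ℂ} (hz : z ∈ D) (hw : w ∈ D) (hzw : g z = f w) : ‖Q w * R z‖ < c := by
  by_contra! hlt
  have hKL : IsCompact (K ×ˢ L) := hK.prod hL
  have hfst : MapsTo Prod.fst (K ×ˢ L) D := fun e he => hKD he.1
  have hsnd : MapsTo Prod.snd (K ×ˢ L) D := fun e he => hLD he.2
  have hdiff : ContinuousOn (fun e : ℂ × ℂ => g e.1 - f e.2) (K ×ˢ L) :=
    (hg.continuousOn.comp continuousOn_fst hfst).sub
      (hf.continuousOn.comp continuousOn_snd hsnd)
  have hcont : ContinuousOn (fun e : ℂ × ℂ => ‖Q e.2 * R e.1‖) (K ×ˢ L) :=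
    ((hQ.continuousOn.comp continuousOn_snd hsnd).mul
      (hR.continuousOn.comp continuousOn_fst hfst)).norm
  have hE : IsCompact (K ×ˢ L ∩ (fun e : ℂ × ℂ => g e.1 - f e.2) ⁻¹' {0}) :=
    hKL.of_isClosed_subset
      (hdiff.preimage_isClosed_of_isClosed hKL.isClosed isClosed_singleton) inter_subset_left
  obtain ⟨e, he, hemax⟩ := hE.exists_isMaxOn
    ⟨(z, w), hc z hz w hw hzw hlt, by simp [hzw]⟩ (hcont.mono inter_subset_left)
  have hmax : ∀ z ∈ D, ∀ w ∈ D, g z = f w → ‖Q w * R z‖ ≤ ‖Q e.2 * R e.1‖ := by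
    have key : ∀ z ∈ D, ∀ w ∈ D, g z = f w → c ≤ ‖Q w * R z‖ →
        ‖Q w * R z‖ ≤ ‖Q e.2 * R e.1‖ := fun z hz w hw hzw h =>
      hemax (a := (z, w)) ⟨hc z hz w hw hzw h, by simp [hzw]⟩
    intro z' hz' w' hw' h
    rcases le_total c ‖Q w' * R z'‖ with h' | h'
    · exact key z' hz' w' hw' h h'
    · exact h'.trans (hlt.trans (key z hz w hw hzw hlt))
  have hce : c ≤ ‖Q e.2 * R e.1‖ := hlt.trans (hmax z hz w hw hzw)
  -- The projection of the maximum set is open by the local principle and compact by `hc`; no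
  -- nonempty subset of `ℂ` is both.
  let A : Set ℂ := {z | z ∈ D ∧ ∃ w ∈ D, g z = f w ∧ ‖Q w * R z‖ = ‖Q e.2 * R e.1‖}
  have hAopen : IsOpen A := by
    rw [isOpen_iff_mem_nhds]
    rintro z₀ ⟨hz₀, w₀, hw₀, h1, h2⟩
    filter_upwards [hD.mem_nhds hz₀, eventually_exists_norm_mul_eq (hf w₀ hw₀) (hg z₀ hz₀)
      (hfn w₀ hw₀) (hgn z₀ hz₀) (hQ w₀ hw₀) (hR z₀ hz₀) h1 (hD.mem_nhds hz₀) (hD.mem_nhds hw₀)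
      (fun z hz w hw h => (hmax z hz w hw h).trans h2.ge)] with z hz ⟨w, hw, h3, h4⟩
    exact ⟨hz, w, hw, h3, h4.trans h2⟩
  have hAeq : A = Prod.fst '' ((K ×ˢ L ∩ (fun e : ℂ × ℂ => g e.1 - f e.2) ⁻¹' {0}) ∩
      (fun e : ℂ × ℂ => ‖Q e.2 * R e.1‖) ⁻¹' {‖Q e.2 * R e.1‖}) := by
    ext z
    constructor
    · rintro ⟨hz, w, hw, h1, h2⟩
      exact ⟨(z, w), ⟨⟨hc z hz w hw h1 (hce.trans h2.ge), by simp [h1]⟩, h2⟩, rfl⟩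
    · rintro ⟨⟨z, w⟩, ⟨⟨h1, h2⟩, h3⟩, rfl⟩
      exact ⟨hKD h1.1, w, hLD h1.2, sub_eq_zero.1 h2, h3⟩
  have hAcompact : IsCompact A := by
    rw [hAeq]
    refine IsCompact.image (hE.of_isClosed_subset ?_ inter_subset_left) continuous_fst
    exact (hcont.mono inter_subset_left).preimage_isClosed_of_isClosed hE.isClosed
      isClosed_singleton
  have hAne : A.Nonempty :=
    ⟨e.1, hKD he.1.1, e.2, hLD he.1.2, sub_eq_zero.1 he.2, rfl⟩
  have hAuniv : A = univ := IsClopen.eq_univ ⟨hAcompact.isClosed, hAopen⟩ hAne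
  exact noncompact_univ ℂ (hAuniv ▸ hAcompact)

/-! ### Factoring out zeros -/

/-- Division by a power of `z - a`. -/
theorem exists_eq_pow_mul {U : Set ℂ} (hU : IsOpen U) {a : ℂ} (ha : a ∈ U) (n : ℕ) :
    ∀ {F : ℂ → ℂ}, DifferentiableOn ℂ F U → (n : ℕ∞) ≤ analyticOrderAt F a →
      ∃ q : ℂ → ℂ, DifferentiableOn ℂ q U ∧ ∀ z ∈ U, F z = (z - a) ^ n * q z := by
  induction n with
  | zero => exact fun {F} hF _ => ⟨F, hF, fun z _ => by simp⟩
  | succ n ih =>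
    intro F hF hn
    have hFa : F a = 0 := by
      refine apply_eq_zero_of_analyticOrderAt_ne_zero fun h => ?_
      rw [h] at hn
      simp at hn
    have hd : DifferentiableOn ℂ (dslope F a) U :=
      (Complex.differentiableOn_dslope (hU.mem_nhds ha)).2 hF
    have hmul : ∀ z, F z = (z - a) * dslope F a z := fun z => by
      have := sub_smul_dslope F a z
      rw [hFa, sub_zero, smul_eq_mul] at this
      exact this.symm
    have hord : analyticOrderAt F a = 1 + analyticOrderAt (dslope F a) a := by
      have h1 : F = (fun z => z - a) * dslope F a := funext hmul
      conv_lhs => rw [h1]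
      rw [analyticOrderAt_mul (by fun_prop) (hd.analyticAt (hU.mem_nhds ha)),
        analyticOrderAt_id_sub_const_self]
    have hn' : (n : ℕ∞) ≤ analyticOrderAt (dslope F a) a := by
      rw [hord, Nat.cast_succ, add_comm] at hn
      exact (ENat.add_le_add_iff_left (by simp)).1 hn
    obtain ⟨q, hq, hqe⟩ := ih hd hn'
    exact ⟨q, hq, fun z hz => by rw [hmul, hqe z hz]; ring⟩

/-- Division by finitely many zeros. -/
theorem exists_eq_prod_mul {U : Set ℂ} (hU : IsOpen U) (n : ℂ → ℕ) {F : ℂ → ℂ}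
    (hF : DifferentiableOn ℂ F U) (S : Finset ℂ) (hS : ∀ a ∈ S, a ∈ U)
    (hn : ∀ a ∈ S, (n a : ℕ∞) ≤ analyticOrderAt F a) :
    ∃ q : ℂ → ℂ, DifferentiableOn ℂ q U ∧
      ∀ z ∈ U, F z = (∏ a ∈ S, (z - a) ^ n a) * q z := by
  induction S using Finset.induction_on with
  | empty => exact ⟨F, hF, fun z _ => by simp⟩
  | insert b S hb ih =>
    obtain ⟨q, hq, hqe⟩ := ih (fun a ha => hS a (Finset.mem_insert_of_mem ha))
      (fun a ha => hn a (Finset.mem_insert_of_mem ha))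
    have hbU : b ∈ U := hS b (Finset.mem_insert_self _ _)
    have hP : AnalyticAt ℂ (fun z => ∏ a ∈ S, (z - a) ^ n a) b := by fun_prop
    have hP0 : analyticOrderAt (fun z => ∏ a ∈ S, (z - a) ^ n a) b = 0 := by
      rw [hP.analyticOrderAt_eq_zero, Finset.prod_ne_zero_iff]
      intro a ha
      exact pow_ne_zero _ (sub_ne_zero.2 fun h => hb (h ▸ ha))
    have hord : analyticOrderAt F b = analyticOrderAt q b := by
      have h1 : F =ᶠ[𝓝 b] (fun z => ∏ a ∈ S, (z - a) ^ n a) * q := by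
        filter_upwards [hU.mem_nhds hbU] with z hz using hqe z hz
      rw [analyticOrderAt_congr h1, analyticOrderAt_mul hP (hq.analyticAt (hU.mem_nhds hbU)),
        hP0, zero_add]
    obtain ⟨q', hq', hqe'⟩ := exists_eq_pow_mul hU hbU (n b) hq
      (hord ▸ hn b (Finset.mem_insert_self _ _))
    refine ⟨q', hq', fun z hz => ?_⟩
    rw [hqe z hz, hqe' z hz, Finset.prod_insert hb]
    ring

/-- Division by all zeros, when there are finitely many. -/
theorem exists_eq_prod_mul_ne_zero {U : Set ℂ} (hU : IsOpen U) (n : ℂ → ℕ) {F : ℂ → ℂ}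
    (hF : DifferentiableOn ℂ F U) (S : Finset ℂ) (hS : ∀ a, a ∈ S ↔ a ∈ U ∧ F a = 0)
    (hn : ∀ a ∈ S, analyticOrderAt F a = n a) :
    ∃ q : ℂ → ℂ, DifferentiableOn ℂ q U ∧ (∀ z ∈ U, q z ≠ 0) ∧
      ∀ z ∈ U, F z = (∏ a ∈ S, (z - a) ^ n a) * q z := by
  obtain ⟨q, hq, hqe⟩ := exists_eq_prod_mul hU n hF S (fun a ha => ((hS a).1 ha).1)
    (fun a ha => (hn a ha).ge)
  refine ⟨q, hq, fun b hb hqb => ?_, hqe⟩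
  have hbS : b ∈ S := (hS b).2 ⟨hb, by rw [hqe b hb, hqb, mul_zero]⟩
  have hqa : AnalyticAt ℂ q b := hq.analyticAt (hU.mem_nhds hb)
  -- A zero of `q` at `b` would raise the order of `F` there above `n b`.
  have hle : ((n b + 1 : ℕ) : ℕ∞) ≤ analyticOrderAt F b := by
    obtain ⟨r, hr, hre⟩ := (natCast_le_analyticOrderAt hqa (n := 1)).1 (by
      rw [Nat.cast_one, Order.one_le_iff_ne_zero]
      exact hqa.analyticOrderAt_ne_zero.2 hqb)
    rw [natCast_le_analyticOrderAt (hF.analyticAt (hU.mem_nhds hb))]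
    refine ⟨fun z => (∏ a ∈ S.erase b, (z - a) ^ n a) * r z,
      AnalyticAt.fun_mul (by fun_prop) hr, ?_⟩
    filter_upwards [hre, hU.mem_nhds hb] with z hz hzU
    rw [hqe z hzU, hz, ← Finset.mul_prod_erase S _ hbS, smul_eq_mul, smul_eq_mul]
    ring
  rw [hn b hbS] at hle
  exact absurd (Nat.cast_le.1 hle) (by omega)

/-! ### Finite Blaschke products -/

/-- The finite Blaschke product with zeros `a ∈ S` of multiplicities `n a`. -/
noncomputable def blaschke (S : Finset ℂ) (n : ℂ → ℕ) (z : ℂ) : ℂ :=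
  ∏ a ∈ S, ((z - a) / (1 - (starRingEnd ℂ) a * z)) ^ n a

theorem one_sub_conj_mul_ne_zero {a z : ℂ} (ha : ‖a‖ < 1) (hz : ‖z‖ ≤ 1) :
    1 - (starRingEnd ℂ) a * z ≠ 0 := by
  intro h
  have h1 : ‖(starRingEnd ℂ) a * z‖ = 1 := by rw [← sub_eq_zero.1 h, norm_one]
  rw [norm_mul, RCLike.norm_conj] at h1
  nlinarith [norm_nonneg a, norm_nonneg z]

/-- Source of both bounds on a Blaschke factor: the right side is nonnegative on the closed disc and
vanishes on the circle. -/
theorem norm_sq_one_sub_conj_mul (a z : ℂ) :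
    ‖1 - (starRingEnd ℂ) a * z‖ ^ 2 - ‖z - a‖ ^ 2 = (1 - ‖a‖ ^ 2) * (1 - ‖z‖ ^ 2) := by
  simp only [← Complex.normSq_eq_norm_sq, Complex.normSq_apply, Complex.sub_re, Complex.sub_im,
    Complex.mul_re, Complex.mul_im, Complex.conj_re, Complex.conj_im, Complex.one_re,
    Complex.one_im]
  ring

theorem norm_blaschke_le_one {S : Finset ℂ} (hS : ∀ a ∈ S, ‖a‖ < 1) (n : ℂ → ℕ) {z : ℂ}
    (hz : ‖z‖ ≤ 1) : ‖blaschke S n z‖ ≤ 1 := by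
  rw [blaschke, norm_prod]
  refine Finset.prod_le_one (fun _ _ => norm_nonneg _) fun a ha => ?_
  rw [norm_pow, norm_div]
  refine pow_le_one₀ (by positivity) (div_le_one_of_le₀ ?_ (norm_nonneg _))
  refine le_of_sq_le_sq ?_ (norm_nonneg _)
  nlinarith [norm_sq_one_sub_conj_mul a z, norm_nonneg a, norm_nonneg z, hS a ha,
    mul_nonneg (show 0 ≤ 1 - ‖a‖ ^ 2 by nlinarith [norm_nonneg a, hS a ha])
      (show 0 ≤ 1 - ‖z‖ ^ 2 by nlinarith [norm_nonneg z])]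

theorem norm_blaschke_eq_one {S : Finset ℂ} (hS : ∀ a ∈ S, ‖a‖ < 1) (n : ℂ → ℕ) {z : ℂ}
    (hz : ‖z‖ = 1) : ‖blaschke S n z‖ = 1 := by
  rw [blaschke, norm_prod]
  refine Finset.prod_eq_one fun a ha => ?_
  have h1 := norm_ne_zero_iff.2 (one_sub_conj_mul_ne_zero (hS a ha) hz.le)
  have h2 : ‖z - a‖ = ‖1 - (starRingEnd ℂ) a * z‖ := by
    refine (sq_eq_sq₀ (norm_nonneg _) (norm_nonneg _)).1 ?_
    have := norm_sq_one_sub_conj_mul a z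
    rw [hz] at this
    linarith
  rw [norm_pow, norm_div, h2, div_self h1, one_pow]

theorem continuousOn_blaschke {S : Finset ℂ} (hS : ∀ a ∈ S, ‖a‖ < 1) (n : ℂ → ℕ) :
    ContinuousOn (blaschke S n) (closedBall 0 1) := by
  refine continuousOn_finsetProd S fun a ha => ContinuousOn.pow (ContinuousOn.div ?_ ?_ ?_) _
  · fun_prop
  · fun_prop
  · exact fun z hz => one_sub_conj_mul_ne_zero (hS a ha) (by simpa using hz)

theorem blaschke_zero (S : Finset ℂ) (n : ℂ → ℕ) : blaschke S n 0 = ∏ a ∈ S, (-a) ^ n a := by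
  simp [blaschke]

theorem blaschke_eq_div (S : Finset ℂ) (n : ℂ → ℕ) (z : ℂ) :
    blaschke S n z = (∏ a ∈ S, (z - a) ^ n a) / ∏ a ∈ S, (1 - (starRingEnd ℂ) a * z) ^ n a := by
  simp [blaschke, div_pow, Finset.prod_div_distrib]

/-- The Lindelöf principle for Blaschke products. -/
theorem norm_blaschke_le_of_proper {f g : ℂ → ℂ}
    (hf : DifferentiableOn ℂ f (ball 0 1)) (hg : DifferentiableOn ℂ g (ball 0 1))
    (hfn : ∀ w ∈ ball (0 : ℂ) 1, ¬ ∀ᶠ z in 𝓝 w, f z = f w)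
    (hgn : ∀ w ∈ ball (0 : ℂ) 1, ¬ ∀ᶠ z in 𝓝 w, g z = g w)
    (hproper : ∀ K ⊆ f '' ball 0 1, IsCompact K → IsCompact (ball 0 1 ∩ f ⁻¹' K))
    (hgf : g '' ball 0 1 ⊆ f '' ball 0 1) {p : ℂ} {S T : Finset ℂ} {m n : ℂ → ℕ}
    (hS : ∀ a, a ∈ S ↔ a ∈ ball (0 : ℂ) 1 ∧ f a = p)
    (hm : ∀ a ∈ S, analyticOrderAt (fun z => f z - p) a = m a)
    (hT : ∀ b ∈ T, b ∈ ball (0 : ℂ) 1)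
    (hn : ∀ b ∈ T, (n b : ℕ∞) ≤ analyticOrderAt (fun z => g z - p) b)
    {z w : ℂ} (hz : z ∈ ball (0 : ℂ) 1) (hw : w ∈ ball (0 : ℂ) 1) (hzw : g z = f w) :
    ‖blaschke S m w‖ ≤ ‖blaschke T n z‖ := by
  have hS1 : ∀ a ∈ S, ‖a‖ < 1 := fun a ha => by simpa using ((hS a).1 ha).1
  have hT1 : ∀ b ∈ T, ‖b‖ < 1 := fun b hb => by simpa using hT b hb
  have hden : ∀ {A : Finset ℂ} (k : ℂ → ℕ), (∀ a ∈ A, ‖a‖ < 1) → ∀ z ∈ ball (0 : ℂ) 1,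
      ∏ a ∈ A, (1 - (starRingEnd ℂ) a * z) ^ k a ≠ 0 := fun k hA z hz =>
    Finset.prod_ne_zero_iff.2 fun a ha =>
      pow_ne_zero _ (one_sub_conj_mul_ne_zero (hA a ha) (by simpa using (mem_ball.1 hz).le))
  obtain ⟨q, hq, hq0, hqe⟩ := exists_eq_prod_mul_ne_zero isOpen_ball m (hf.sub_const p) S
    (fun a => by rw [hS, sub_eq_zero]) hm
  obtain ⟨r, hr, hre⟩ := exists_eq_prod_mul isOpen_ball n (hg.sub_const p) T hT hn
  -- `B_S / (f - p)` and `(g - p) / B_T` with the common zeros already cancelled.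
  let Q : ℂ → ℂ := fun w => (q w * ∏ a ∈ S, (1 - (starRingEnd ℂ) a * w) ^ m a)⁻¹
  let R : ℂ → ℂ := fun z => r z * ∏ b ∈ T, (1 - (starRingEnd ℂ) b * z) ^ n b
  have hQ : AnalyticOnNhd ℂ Q (ball 0 1) := fun w hw =>
    AnalyticAt.fun_inv ((hq.analyticAt (isOpen_ball.mem_nhds hw)).fun_mul (by fun_prop))
      (mul_ne_zero (hq0 w hw) (hden m hS1 w hw))
  have hR : AnalyticOnNhd ℂ R (ball 0 1) := fun z hz =>
    (hr.analyticAt (isOpen_ball.mem_nhds hz)).fun_mul (by fun_prop)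
  have hQR : ∀ z ∈ ball (0 : ℂ) 1, ∀ w ∈ ball (0 : ℂ) 1, g z = f w →
      Q w * R z * blaschke T n z = blaschke S m w := by
    intro z hz w hw h
    have h1 : R z * blaschke T n z = f w - p := by
      rw [← h, hre z hz, blaschke_eq_div]
      have := hden n hT1 z hz
      rw [mul_div_assoc', div_eq_iff this]
      simp only [R]
      ring
    have h2 : Q w * (f w - p) = blaschke S m w := by
      rw [hqe w hw, blaschke_eq_div]
      have h3 := hden m hS1 w hw
      have h4 := hq0 w hw
      simp only [Q]
      rw [eq_div_iff h3, inv_mul_eq_div, div_mul_eq_mul_div, div_eq_iff (mul_ne_zero h4 h3)]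
      ring
    rw [mul_assoc, h1, h2]
  have hle : ‖Q w * R z‖ ≤ 1 := by
    refine le_of_forall_gt_imp_ge_of_dense fun c hc => ?_
    have hc0 : 0 < c := one_pos.trans hc
    -- Where `|Q R| ≥ c > 1`, the bound `|B_S| ≤ 1` forces `|B_T(z)| ≤ c⁻¹`, which excludes the
    -- circle.
    let K : Set ℂ := closedBall 0 1 ∩ (fun z => ‖blaschke T n z‖) ⁻¹' Iic c⁻¹
    have hK : IsCompact K := (isCompact_closedBall 0 1).of_isClosed_subset
      ((continuousOn_blaschke hT1 n).norm.preimage_isClosed_of_isClosed isClosed_closedBall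
        isClosed_Iic) inter_subset_left
    have hKD : K ⊆ ball 0 1 := by
      rintro x ⟨hx, hx1⟩
      rw [mem_closedBall_zero_iff] at hx
      rw [mem_ball_zero_iff]
      refine lt_of_le_of_ne hx fun h => ?_
      have hx2 : ‖blaschke T n x‖ ≤ c⁻¹ := hx1
      rw [norm_blaschke_eq_one hT1 n h] at hx2
      exact absurd hx2 (not_le.2 (inv_lt_one_of_one_lt₀ hc))
    have hL : IsCompact (ball 0 1 ∩ f ⁻¹' (g '' K)) :=
      hproper _ ((image_mono hKD).trans hgf) (hK.image_of_continuousOn (hg.continuousOn.mono hKD))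
    refine (norm_mul_lt_of_compact isOpen_ball (hf.analyticOnNhd isOpen_ball)
      (hg.analyticOnNhd isOpen_ball) hfn hgn hQ hR hK hL hKD inter_subset_left ?_ hz hw hzw).le
    intro z hz w hw h hle
    have hzK : z ∈ K := by
      refine ⟨ball_subset_closedBall hz, ?_⟩
      have h1 : ‖Q w * R z‖ * ‖blaschke T n z‖ ≤ 1 := by
        rw [← norm_mul, hQR z hz w hw h]
        exact norm_blaschke_le_one hS1 m (mem_ball_zero_iff.1 hw).le
      change ‖blaschke T n z‖ ≤ c⁻¹
      rw [← one_div, le_div_iff₀' hc0]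
      exact (mul_le_mul_of_nonneg_right hle (norm_nonneg _)).trans h1
    exact ⟨hzK, hw, z, hzK, h⟩
  rw [← hQR z hz w hw hzw, norm_mul]
  exact mul_le_of_le_one_left (norm_nonneg _) hle

/-! ### Logarithmic sums and properness -/

theorem logSum_le_sum (h : ℂ → ℂ) (p : ℂ) (S : Finset ℂ) (hS : ∀ a ∈ S, a ∈ fiber h p) :
    logSum h p ≤ ∑ a ∈ S, term h p a := by
  classical
  have hanti : Antitone fun s : Finset (fiber h p) => ∑ a ∈ s, term h p a := fun s t hst =>
    Finset.sum_le_sum_of_subset_of_nonpos' hst fun a _ _ => term_nonpos h p a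
  have := hanti.le_of_tendsto (hasSum_logSum h p) (S.subtype (· ∈ fiber h p))
  rwa [Finset.sum_subtype_of_mem (term h p) hS] at this

theorem le_logSum {h : ℂ → ℂ} {p : ℂ} {c : EReal}
    (hc : ∀ S : Finset ℂ, (∀ a ∈ S, a ∈ fiber h p) → c ≤ ∑ a ∈ S, term h p a) :
    c ≤ logSum h p := by
  refine ge_of_tendsto' (hasSum_logSum h p) fun s => ?_
  have := hc (s.map (Function.Embedding.subtype _)) (by
    intro a ha
    obtain ⟨b, -, rfl⟩ := Finset.mem_map.1 ha
    exact b.2)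
  rwa [Finset.sum_map] at this

theorem sum_term_eq_log (h : ℂ → ℂ) (p : ℂ) (S : Finset ℂ) (n : ℂ → ℕ)
    (hn : ∀ a ∈ S, mult h p a = n a) :
    ∑ a ∈ S, term h p a = ENNReal.log ‖blaschke S n 0‖ₑ := by
  have hterm : ∀ a ∈ S, term h p a = ENNReal.log (‖a‖ₑ ^ n a) := fun a ha => by
    rw [term, hn a ha, ENNReal.log_pow]
    norm_cast
  rw [Finset.sum_congr rfl hterm, blaschke_zero]
  clear hterm hn
  induction S using Finset.induction_on with
  | empty => simp
  | insert b S hb ih =>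
    rw [Finset.sum_insert hb, Finset.prod_insert hb, ih, enorm_mul, ENNReal.log_mul_add,
      enorm_pow, enorm_neg]

theorem ProperOntoImage.isCompact_preimage {f : ℂ → ℂ} (hf : ProperOntoImage f) {K : Set ℂ}
    (hKf : K ⊆ f '' ball 0 1) (hK : IsCompact K) : IsCompact (ball 0 1 ∩ f ⁻¹' K) := by
  have h1 : IsCompact ((↑) ⁻¹' K : Set (f '' ball (0 : ℂ) 1)) := by
    rw [Topology.IsInducing.subtypeVal.isCompact_iff, Subtype.image_preimage_coe,
      inter_eq_self_of_subset_right hKf]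
    exact hK
  have h2 := (IsProperMap.isCompact_preimage hf h1).image continuous_subtype_val
  convert h2 using 1
  ext z
  constructor
  · rintro ⟨hz, hzK⟩
    exact ⟨⟨z, hz⟩, hzK, rfl⟩
  · rintro ⟨⟨z, hz⟩, hzK, rfl⟩
    exact ⟨hz, hzK⟩

/-- A holomorphic function on the disc which is locally constant somewhere is constant. -/
theorem eqOn_of_eventually_eq {f : ℂ → ℂ} (hf : DifferentiableOn ℂ f (ball 0 1)) {w c : ℂ}
    (hw : w ∈ ball (0 : ℂ) 1) (h : ∀ᶠ z in 𝓝 w, f z = c) : ∀ z ∈ ball (0 : ℂ) 1, f z = c :=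
  (hf.analyticOnNhd isOpen_ball).eqOn_of_preconnected_of_eventuallyEq
    (g := fun _ => c) analyticOnNhd_const (convex_ball 0 1).isPreconnected hw h

theorem not_isCompact_ball : ¬ IsCompact (ball (0 : ℂ) 1) := by
  intro h
  have h1 := IsClopen.eq_univ ⟨h.isClosed, isOpen_ball⟩ ⟨(0 : ℂ), by simp⟩
  exact noncompact_univ ℂ (h1 ▸ h)

end LogFiber

open LogFiber

theorem corollary5 (X : Set ℂ) (hX : IsOpen X) (f : ℂ → ℂ)
    (hf : DifferentiableOn ℂ f (ball (0 : ℂ) 1))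
    (hfc : ContinuousOn f (closedBall (0 : ℂ) 1))
    (hfX : MapsTo f (closedBall (0 : ℂ) 1) X)
    (hfp : LogFiber.ProperOntoImage f)
    (g : ℂ → ℂ)
    (hg : DifferentiableOn ℂ g (ball (0 : ℂ) 1))
    (hgX : MapsTo g (ball (0 : ℂ) 1) X)
    (hgf : g '' ball (0 : ℂ) 1 ⊆ f '' ball (0 : ℂ) 1)
    (h0 : g 0 = f 0)
    (p : ℂ) (hp : p ∈ X) :
    LogFiber.logSum g p ≥ LogFiber.logSum f p := by
  have hzero : (0 : ℂ) ∈ ball (0 : ℂ) 1 := by simp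
  have hmulpos : ∀ {h : ℂ → ℂ} {a : ℂ}, DifferentiableOn ℂ h (ball 0 1) → a ∈ ball (0 : ℂ) 1 →
      h a = p → mult h p a ≠ 0 := fun hh ha hap => by
    rw [mult, AnalyticAt.analyticOrderAt_ne_zero
      ((hh.sub_const p).analyticAt (isOpen_ball.mem_nhds ha)), hap, sub_self]
  refine le_logSum fun T hT => ?_
  -- Here the fibre of `f` contains 0, so its sum is `⊥`. Otherwise `g 0 ≠ p`, which rules out `g ≡
  -- p`.
  by_cases hp0 : f 0 = p
  · have hbot : logSum f p ≤ ⊥ := by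
      refine (logSum_le_sum f p {0} fun a ha => ?_).trans ?_
      · rw [Finset.mem_singleton.1 ha]
        exact ⟨hzero, hp0⟩
      · rw [Finset.sum_singleton, term, enorm_zero, ENNReal.log_zero, EReal.mul_bot_of_pos]
        simpa [pos_iff_ne_zero] using hmulpos hf hzero hp0
    exact hbot.trans bot_le
  rcases T.eq_empty_or_nonempty with rfl | ⟨b, hb⟩
  · simpa using logSum_le_sum f p ∅ (by simp)
  have hpf : p ∈ f '' ball 0 1 := hgf ⟨b, (hT b hb).1, (hT b hb).2⟩
  have hproper : ∀ K ⊆ f '' ball 0 1, IsCompact K → IsCompact (ball 0 1 ∩ f ⁻¹' K) :=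
    fun K => hfp.isCompact_preimage
  -- For constant `f`, the preimage of its value would be the whole, noncompact disc.
  have hfn : ∀ w ∈ ball (0 : ℂ) 1, ∀ c, ¬ ∀ᶠ z in 𝓝 w, f z = c := by
    intro w hw c h
    have hc := eqOn_of_eventually_eq hf hw h
    have h1 := hproper {c} (singleton_subset_iff.2 ⟨w, hw, hc w hw⟩) isCompact_singleton
    exact not_isCompact_ball (inter_eq_self_of_subset_left (t := f ⁻¹' {c}) hc ▸ h1)
  have hgn : ∀ w ∈ ball (0 : ℂ) 1, ∀ c, ¬ ∀ᶠ z in 𝓝 w, g z = c := by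
    intro w hw c h
    have hc := eqOn_of_eventually_eq hg hw h
    exact hp0 (by rw [← h0, hc 0 hzero, ← hc b (hT b hb).1, (hT b hb).2])
  -- An infinite compact fibre would accumulate inside the disc, against the identity theorem.
  have hfin : (ball 0 1 ∩ f ⁻¹' {p}).Finite := by
    by_contra hinf
    obtain ⟨x, hx, hacc⟩ := Set.Infinite.exists_accPt_of_subset_isCompact hinf
      (hproper {p} (singleton_subset_iff.2 hpf) isCompact_singleton) subset_rfl
    refine hfn x hx.1 p (((hf.analyticAt
      (isOpen_ball.mem_nhds hx.1)).frequently_eq_iff_eventually_eq analyticAt_const).1 ?_)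
    exact (accPt_iff_frequently_nhdsNE.1 hacc).mono fun z hz => hz.2
  have hcast : ∀ {h : ℂ → ℂ}, (∀ w ∈ ball (0 : ℂ) 1, ∀ c, ¬ ∀ᶠ z in 𝓝 w, h z = c) →
      ∀ a ∈ ball (0 : ℂ) 1, mult h p a = (mult h p a).toNat := fun hh a ha => by
    refine (ENat.natCast_toNat fun htop => hh a ha p ?_).symm
    simpa [sub_eq_zero] using analyticOrderAt_eq_top.1 htop
  have hS : ∀ a, a ∈ hfin.toFinset ↔ a ∈ ball (0 : ℂ) 1 ∧ f a = p := fun a => by simp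
  have hfm := fun a ha => hcast hfn a ((hS a).1 ha).1
  have hgm := fun a ha => hcast hgn a (hT a ha).1
  calc logSum f p ≤ ∑ a ∈ hfin.toFinset, term f p a :=
        logSum_le_sum f p _ fun a ha => (hS a).1 ha
    _ = ENNReal.log ‖blaschke hfin.toFinset (fun a => (mult f p a).toNat) 0‖ₑ :=
        sum_term_eq_log f p _ _ hfm
    _ ≤ ENNReal.log ‖blaschke T (fun a => (mult g p a).toNat) 0‖ₑ :=
        ENNReal.log_monotone (enorm_le_iff_norm_le.2 (norm_blaschke_le_of_proper hf hg
          (fun w hw => hfn w hw _) (fun w hw => hgn w hw _) hproper hgf hS hfm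
          (fun a ha => (hT a ha).1) (fun a ha => (hgm a ha).ge) hzero hzero h0))
    _ = ∑ a ∈ T, term g p a := (sum_term_eq_log g p _ _ hgm).symm
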